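/- An instance $I$ of *Fault-Tolerant $\ell$-Flow Augmentation* consists of a finite digraph $D=(V,A)$ with arc weights $c\ge 0$, nodes $s,t$, a set $X_0\subseteq A$ containing $\ell$ arc-disjoint $s$-$t$ paths, and a set $M\subseteq A$ of vulnerable arcs. A *feasible solution* is a set $S\subseteq A\setminus X_0$ such that for every $f\in M$ the set $(X_0\cup S)\setminus\{f\}$ contains $\ell$ arc-disjoint $s$-$t$ paths; it is *optimal* if $c(S)=\sum_{a\in S}c(a)$ is minimum among feasible solutions. The algorithm is as follows. Choose arc-disjoint simple $s$-$t$ paths $P_1,\dots,P_\ell$ in $X_0$. Preprocessing: every arc of $X_0$ on none of these paths is removed from $X_0$ and gets weight $0$; write $X_0'=\bigcup_i P_i$ and $c'$ for the resulting arc set and weights, and $I'$ for the resulting instance. For vertices $x_i,y_i$ of $P_i$ write $x_i\le y_i$ if $x_i$ is at least as close to $s$ on $P_i$ as $y_i$, and then let $Q_i(x_i,y_i)$ be the set of arcs of the subpath of $P_i$ from $x_i$ to $y_i$. Let $\mathcal D$ be the digraph whose nodes are the tuples $x=(x_1,\dots,x_\ell)$ with $x_i$ a vertex of $P_i$, where $x\le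 y$ means $x_i\le y_i$ for all $i$, and whose links are: - ($\mathcal A_1$) $xy$ with $x\le y$ and $Q_i(x_i,y_i)\cap M=\emptyset$ for all $i$; its weight is $0$; - ($\mathcal A_2$) $xy$ with $x\le y$ and $Q_i(x_i,y_i)\cap M\ne\emptyset$ for some $i$, for which the following Directed Steiner Network instance $I(x,y)$ has a solution and the computed optimal solution $F(x,y)$ is strongly connected; its weight is the cost of $F(x,y)$. The arcs of $I(x,y)$ are those of $A\setminus X_0'$, at cost $c'$, and the reversed arcs of all $Q_i(x_i,y_i)$, at cost $0$ (a reversed arc is kept distinct from any arc of $A \setminus X_0'$ parallel to it); a solution is a set of these arcs that contains a path from $x_i$ to $y_i$ for every $i$. Here $F(x,y)$ is called strongly connected if all $x_i,y_i$ with $x_i\neq y_i$ lie in one strongly connected component of the graph formed by $F(x,y)$ and all the free reversed arcs. Find a path $\mathcal P$ of minimum weight in $\mathcal D$ from $(s,\dots,s)$ to $(t,\dots,t)$, and let $Y$ be the set of all arcs of $A\setminus X_0'$ that lie in $F(x,y)$ for some link $xy\in\mathcal A_2$ of $\mathcal P$. **Theorem.** For every choice of the paths $P_i$, of the optimal solutions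 $F(x,y)$ and of the shortest path $\mathcal P$, the set $Y$ computed by the algorithm is an optimal solution to $I'$, and $Y\setminus X_0$ is an optimal solution to $I$ (if $X_0=\bigcup_iP_i$, then $I'=I$ and $Y\setminus X_0=Y$). Moreover, if $I$ has a feasible solution, then $\mathcal D$ has a path from $(s,\dots,s)$ to $(t,\dots,t)$, so that the algorithm does return a set. -/

import Mathlib

open scoped NNReal

/-- A directed graph with vertices in `V` and arcs in `A`. Parallel arcs and loops are allowed; a
simple digraph is the case where `A` is a set of ordered pairs of vertices. -/
structure MultiDigraph (V A : Type*) where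
  src : A → V
  tgt : A → V

namespace MultiDigraph

/-- `v` is reachable from `u` by a directed path all of whose arcs lie in `F`. -/
def Reach {V A : Type*} (G : MultiDigraph V A) (F : Finset A) : V → V → Prop :=
  Relation.ReflTransGen fun u v => ∃ a ∈ F, G.src a = u ∧ G.tgt a = v

/-- The digraph obtained by reversing exactly the arcs in `X`. -/
def flip {V A : Type*} [DecidableEq A] (G : MultiDigraph V A) (X : Finset A) :
    MultiDigraph V A where
  src a := if a ∈ X then G.tgt a else G.src a
  tgt a := if a ∈ X then G.src a else G.tgt a

/-- A (simple) directed `s`-`t` path with vertices `vert 0, …, vert len` and arcs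
`arc 0, …, arc (len - 1)`. -/
structure DiPath {V A : Type*} (G : MultiDigraph V A) (s t : V) where
  len : ℕ
  vert : Fin (len + 1) → V
  arc : Fin len → A
  src_arc : ∀ k, G.src (arc k) = vert k.castSucc
  tgt_arc : ∀ k, G.tgt (arc k) = vert k.succ
  vert_zero : vert 0 = s
  vert_last : vert (Fin.last len) = t
  vert_injective : Function.Injective vert

/-- `ℓ` pairwise arc-disjoint `s`-`t` paths contained in the arc set `X`. -/
structure DisjointPaths {V A : Type*} (G : MultiDigraph V A) (s t : V) (ℓ : ℕ) (X : Finset A) where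
  path : Fin ℓ → G.DiPath s t
  arc_mem : ∀ i k, (path i).arc k ∈ X
  disjoint : ∀ i j, i ≠ j → ∀ k m, (path i).arc k ≠ (path j).arc m

/-- The union of the arc sets of the paths. -/
def DisjointPaths.arcs {V A : Type*} [DecidableEq A] {G : MultiDigraph V A} {s t : V} {ℓ : ℕ}
    {X : Finset A} (P : G.DisjointPaths s t ℓ X) : Finset A :=
  Finset.univ.biUnion fun i => Finset.univ.image (P.path i).arc

/-- The same paths, regarded as contained in their union. -/
def DisjointPaths.core {V A : Type*} [DecidableEq A] {G : MultiDigraph V A} {s t : V} {ℓ : ℕ}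
    {X : Finset A} (P : G.DisjointPaths s t ℓ X) : G.DisjointPaths s t ℓ P.arcs where
  path := P.path
  arc_mem i k := Finset.mem_biUnion.2
    ⟨i, Finset.mem_univ i, Finset.mem_image_of_mem _ (Finset.mem_univ k)⟩
  disjoint := P.disjoint

end MultiDigraph

/-- An instance of Directed Steiner Network: a digraph whose arcs are the members of `avail`,
non-negative arc costs, and `ℓ` terminal pairs `(source i, sink i)`. -/
structure DSNInstance (V A : Type*) (ℓ : ℕ) where
  graph : MultiDigraph V A
  avail : Finset A
  cost : A → ℝ≥0
  source : Fin ℓ → V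
  sink : Fin ℓ → V

namespace DSNInstance

/-- `F` contains a path from `source i` to `sink i` for every `i`. -/
def IsSolution {V A : Type*} {ℓ : ℕ} (N : DSNInstance V A ℓ) (F : Finset A) : Prop :=
  F ⊆ N.avail ∧ ∀ i, N.graph.Reach F (N.source i) (N.sink i)

def IsOptimal {V A : Type*} {ℓ : ℕ} (N : DSNInstance V A ℓ) (F : Finset A) : Prop :=
  N.IsSolution F ∧ ∀ F', N.IsSolution F' → ∑ a ∈ F, N.cost a ≤ ∑ a ∈ F', N.cost a

/-- The terminals of the nontrivial terminal pairs. A pair with `source i = sink i` asks for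
nothing and contributes nothing to a solution. -/
def terminals {V A : Type*} {ℓ : ℕ} (N : DSNInstance V A ℓ) : Set V :=
  {v | ∃ i, N.source i ≠ N.sink i ∧ (v = N.source i ∨ v = N.sink i)}

/-- All terminals lie in one strongly connected component of the subgraph with arc set `F`. -/
def StronglyConnects {V A : Type*} {ℓ : ℕ} (N : DSNInstance V A ℓ) (F : Finset A) : Prop :=
  ∀ u ∈ N.terminals, ∀ v ∈ N.terminals, N.graph.Reach F u v

end DSNInstance

/-- An instance of Fault-Tolerant `ℓ`-Flow Augmentation. -/
structure FTAugInstance (V A : Type*) (ℓ : ℕ) where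
  graph : MultiDigraph V A
  c : A → ℝ≥0
  s : V
  t : V
  /-- the arcs that are already present -/
  X₀ : Finset A
  /-- the vulnerable arcs -/
  M : Finset A
  initial : Nonempty (graph.DisjointPaths s t ℓ X₀)

namespace FTAugInstance

/-- `S ⊆ A \ X₀`, and for every vulnerable arc `f` the set `(X₀ ∪ S) \ {f}` contains `ℓ` disjoint
`s`-`t` paths. -/
def IsFeasible {V A : Type*} [DecidableEq A] {ℓ : ℕ} (I : FTAugInstance V A ℓ)
    (S : Finset A) : Prop :=
  Disjoint S I.X₀ ∧
    ∀ f ∈ I.M, Nonempty (I.graph.DisjointPaths I.s I.t ℓ ((I.X₀ ∪ S).erase f))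

def IsOptimal {V A : Type*} [DecidableEq A] {ℓ : ℕ} (I : FTAugInstance V A ℓ)
    (S : Finset A) : Prop :=
  I.IsFeasible S ∧ ∀ S', I.IsFeasible S' → ∑ a ∈ S, I.c a ≤ ∑ a ∈ S', I.c a

/-- A choice of `ℓ` disjoint `s`-`t` paths `P₁, …, P_ℓ` contained in `X₀`. -/
abbrev Paths {V A : Type*} {ℓ : ℕ} (I : FTAugInstance V A ℓ) :=
  I.graph.DisjointPaths I.s I.t ℓ I.X₀

/-- The preprocessing of an instance: every arc of `X₀` that lies on none of the chosen paths is
removed from `X₀` and gets weight `0`. -/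
def normalize {V A : Type*} [DecidableEq A] {ℓ : ℕ} (I : FTAugInstance V A ℓ)
    (P : I.Paths) : FTAugInstance V A ℓ where
  graph := I.graph
  c a := if a ∈ I.X₀ \ P.arcs then 0 else I.c a
  s := I.s
  t := I.t
  X₀ := P.arcs
  M := I.M
  initial := ⟨P.core⟩

section Auxiliary

/-- The nodes of the auxiliary digraph: an `ℓ`-tuple with one vertex on each path `P i`. As the
paths are simple, a vertex of `P i` is given by its position on `P i`, and the componentwise order
of positions is the order of nodes. -/
abbrev Node {V A : Type*} {ℓ : ℕ} (I : FTAugInstance V A ℓ) (P : I.Paths) :=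
  (i : Fin ℓ) → Fin ((P.path i).len + 1)

/-- The node `(s, …, s)`. -/
def startNode {V A : Type*} {ℓ : ℕ} (I : FTAugInstance V A ℓ) (P : I.Paths) : I.Node P :=
  fun _ => 0

/-- The node `(t, …, t)`. -/
def endNode {V A : Type*} {ℓ : ℕ} (I : FTAugInstance V A ℓ) (P : I.Paths) : I.Node P :=
  fun _ => Fin.last _

variable {V A : Type*} [Fintype A] [DecidableEq A] {ℓ : ℕ} (I : FTAugInstance V A ℓ) (P : I.Paths)

/-- The arcs of the subpath `Q_i(x_i, y_i)` of `P i`. -/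
def seg (x y : I.Node P) (i : Fin ℓ) : Finset A :=
  (Finset.univ.filter fun k : Fin (P.path i).len => x i ≤ k.castSucc ∧ k.succ ≤ y i).image
    (P.path i).arc

/-- The arcs of all the subpaths `Q_i(x_i, y_i)`. -/
def segs (x y : I.Node P) : Finset A :=
  Finset.univ.biUnion (I.seg P x y)

/-- The links in `𝒜₁`. -/
def IsLink₁ (x y : I.Node P) : Prop :=
  x ≤ y ∧ ∀ i, Disjoint (I.seg P x y i) I.M

/-- The Directed Steiner Network instance `I(x, y)`. Its arcs are those in `A \ X₀`, at their own
cost, and the arcs of the subpaths `Q_i(x_i, y_i)`, which are reversed and free. -/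
def dsn (x y : I.Node P) : DSNInstance V A ℓ where
  graph := I.graph.flip I.X₀
  avail := (Finset.univ \ I.X₀) ∪ I.segs P x y
  cost a := if a ∈ I.X₀ then 0 else I.c a
  source i := (P.path i).vert (x i)
  sink i := (P.path i).vert (y i)

/-- `sol` is an exact solver for the subinstances: `sol x y` is an optimal solution to `I(x, y)`
(an arbitrary one) whenever `I(x, y)` has a solution. -/
def IsSolver (sol : I.Node P → I.Node P → Finset A) : Prop :=
  ∀ x y, (∃ F, (I.dsn P x y).IsSolution F) → (I.dsn P x y).IsOptimal (sol x y)

variable (sol : I.Node P → I.Node P → Finset A)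

/-- The links in `𝒜₂`: some `Q_i(x_i, y_i)` contains a vulnerable arc, and the computed solution of
`I(x, y)`, taken together with the free reversed subpaths, is strongly connected. -/
def IsLink₂ (x y : I.Node P) : Prop :=
  x ≤ y ∧ (∃ i, ¬ Disjoint (I.seg P x y i) I.M) ∧ (I.dsn P x y).IsSolution (sol x y) ∧
    (I.dsn P x y).StronglyConnects (sol x y ∪ I.segs P x y)

/-- The links of the auxiliary digraph. -/
abbrev Link :=
  {e : I.Node P × I.Node P // I.IsLink₁ P e.1 e.2 ∨ I.IsLink₂ P sol e.1 e.2}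

/-- The auxiliary digraph `𝒟`. -/
def aux : MultiDigraph (I.Node P) (I.Link P sol) where
  src e := e.1.1
  tgt e := e.1.2

/-- The weight of a link: `0` on `𝒜₁`, and on `𝒜₂` the cost of the computed optimal solution. -/
noncomputable def linkWeight (e : I.Link P sol) : ℝ≥0 :=
  open Classical in
  if I.IsLink₁ P e.1.1 e.1.2 then 0
  else ∑ a ∈ sol e.1.1 e.1.2, (I.dsn P e.1.1 e.1.2).cost a

/-- The paths in `𝒟` from `(s, …, s)` to `(t, …, t)`. -/
abbrev AuxPath :=
  (I.aux P sol).DiPath (I.startNode P) (I.endNode P)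

/-- `p` has minimum weight among the paths in `𝒟` from `(s, …, s)` to `(t, …, t)`. -/
def IsShortest (p : I.AuxPath P sol) : Prop :=
  ∀ q : I.AuxPath P sol,
    ∑ k, I.linkWeight P sol (p.arc k) ≤ ∑ k, I.linkWeight P sol (q.arc k)

/-- The set `Y`: for each link of `p` in `𝒜₂`, the arcs of `A \ X₀` in the computed solution. -/
noncomputable def output (p : I.AuxPath P sol) : Finset A :=
  open Classical in
  Finset.univ.biUnion fun k =>
    if I.IsLink₂ P sol (p.arc k).1.1 (p.arc k).1.2 then
      sol (p.arc k).1.1 (p.arc k).1.2 \ I.X₀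
    else ∅

end Auxiliary

end FTAugInstance

/-! Feasibility is a local condition. Reverse the arcs of the paths `P i`. By max-flow/min-cut, a
vulnerable arc `f` on a path can be deleted exactly when the residual digraph leads from the tail of
`f` to its head (`isFeasible_iff`).

Every path in 𝒟 yields a feasible set of at most its weight: some link steps over `f`, necessarily
one in 𝒜₂, and its solution from `x i` to `y i`, together with backward moves along `P i`, leads
from the tail of `f` to its head.

Conversely, a feasible `S` yields a path in 𝒟 of weight at most c(S) (`Protects.exists_isWalk`), by
induction on the number of path arcs between two nodes `x ≤ y`. If `S` with the reversed subpaths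
connects all terminals strongly, it solves I(x, y), so the computed solution is no dearer; if that
solution is strongly connected too, one link suffices. Otherwise `S`, or the computed solution in
its place, leaves some terminal unreachable from another. The reachable set cuts each subpath into
an initial and a final part, no vulnerable arc crosses the cut, and disjoint subsets of the solution
protect the two sides (`Protects.split`).

Preprocessing is harmless because the arcs it discards are free. -/

namespace MultiDigraph

/-! ### Walks, simple paths and reachability -/

section Walks

variable {V A : Type*} {G : MultiDigraph V A}

/-- The arcs of `l`, in this order, form a walk from `u` to `v`. -/
def IsWalk (G : MultiDigraph V A) : V → List A → V → Prop
  | u, [], v => u = v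
  | u, a :: l, v => G.src a = u ∧ G.IsWalk (G.tgt a) l v

theorem IsWalk.append {l m : List A} {u v w : V} (h : G.IsWalk u l v) (h' : G.IsWalk v m w) :
    G.IsWalk u (l ++ m) w := by
  induction l generalizing u with
  | nil => cases h; exact h'
  | cons a l ih => exact ⟨h.1, ih h.2⟩

theorem Reach.exists_isWalk {F : Finset A} {u v : V} (h : G.Reach F u v) :
    ∃ l, G.IsWalk u l v ∧ ∀ a ∈ l, a ∈ F := by
  induction h using Relation.ReflTransGen.head_induction_on with
  | refl => exact ⟨[], rfl, by simp⟩
  | head h _ ih =>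
    obtain ⟨a, ha, hs, ht⟩ := h
    obtain ⟨l, hl, hF⟩ := ih
    exact ⟨a :: l, ⟨hs, ht ▸ hl⟩, by simpa [ha] using hF⟩

/-- The trivial path. -/
def DiPath.nil (G : MultiDigraph V A) (u : V) : G.DiPath u u where
  len := 0
  vert _ := u
  arc := Fin.elim0
  src_arc k := k.elim0
  tgt_arc k := k.elim0
  vert_zero := rfl
  vert_last := rfl
  vert_injective i j _ := Subsingleton.elim (α := Fin 1) i j

/-- The path obtained by putting an arc in front. -/
def DiPath.cons {v : V} (a : A) (q : G.DiPath (G.tgt a) v)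
    (h : ∀ k, q.vert k ≠ G.src a) : G.DiPath (G.src a) v where
  len := q.len + 1
  vert := Fin.cons (G.src a) q.vert
  arc := Fin.cons a q.arc
  src_arc k := by
    refine Fin.cases ?_ (fun k => ?_) k
    · simp
    · simp [q.src_arc]
  tgt_arc k := by
    refine Fin.cases ?_ (fun k => ?_) k
    · simp [q.vert_zero]
    · simp [q.tgt_arc]
  vert_zero := rfl
  vert_last := by simpa [← Fin.succ_last] using q.vert_last
  vert_injective := Fin.cons_injective_iff.2 ⟨fun ⟨k, hk⟩ => h k hk, q.vert_injective⟩

/-- The part of a path that starts at its `k`-th vertex. -/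
def DiPath.drop {u v : V} (q : G.DiPath u v) (k : Fin (q.len + 1)) : G.DiPath (q.vert k) v where
  len := q.len - k
  vert j := q.vert ⟨k + j, by omega⟩
  arc j := q.arc ⟨k + j, by omega⟩
  src_arc j := q.src_arc _
  tgt_arc j := q.tgt_arc _
  vert_zero := rfl
  vert_last := by
    conv_rhs => rw [← q.vert_last]
    congr 1
    ext
    simp
    omega
  vert_injective i j h := by
    have := q.vert_injective h
    simp only [Fin.mk.injEq] at this
    ext
    omega

theorem DiPath.ofFn_arc_drop {u v : V} (q : G.DiPath u v) (k : Fin (q.len + 1)) :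
    List.ofFn (q.drop k).arc = (List.ofFn q.arc).drop k := by
  apply List.ext_getElem
  · simp [DiPath.drop]
  · intro i h₁ h₂
    simp [DiPath.drop]

/-- Cycles are cut out arc by arc. The sublist relation respects multiplicities, so the total weight
of a walk in 𝒟 bounds that of the path extracted from it. -/
theorem IsWalk.exists_diPath {l : List A} {u v : V} (h : G.IsWalk u l v) :
    ∃ q : G.DiPath u v, (List.ofFn q.arc).Sublist l := by
  induction l generalizing u with
  | nil => cases h; exact ⟨DiPath.nil G _, by simp [DiPath.nil]⟩
  | cons a l ih =>
    obtain ⟨rfl, h⟩ := h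
    obtain ⟨q, hq⟩ := ih h
    by_cases hk : ∃ k, q.vert k = G.src a
    · obtain ⟨k, hk⟩ := hk
      rw [← hk]
      exact ⟨q.drop k, q.ofFn_arc_drop k ▸ ((List.drop_sublist _ _).trans hq).cons a⟩
    · push Not at hk
      refine ⟨q.cons a hk, ?_⟩
      have : List.ofFn (q.cons a hk).arc = a :: List.ofFn q.arc := by
        simp [DiPath.cons, List.ofFn_succ]
      exact this ▸ hq.cons_cons a

theorem DiPath.arc_injective {u v : V} (q : G.DiPath u v) : Function.Injective q.arc := by
  intro i j h
  have := congrArg G.src h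
  rw [q.src_arc, q.src_arc] at this
  exact Fin.castSucc_injective _ (q.vert_injective this)

theorem Reach.exists_diPath {F : Finset A} {u v : V} (h : G.Reach F u v) :
    ∃ q : G.DiPath u v, ∀ k, q.arc k ∈ F := by
  obtain ⟨l, hl, hF⟩ := h.exists_isWalk
  obtain ⟨q, hq⟩ := hl.exists_diPath
  exact ⟨q, fun k => hF _ (hq.subset (by simp))⟩

theorem Reach.mono {F F' : Finset A} {u v : V} (h : G.Reach F u v) (hF : F ⊆ F') :
    G.Reach F' u v :=
  Relation.ReflTransGen.mono (fun _ _ ⟨a, ha, h⟩ => ⟨a, hF ha, h⟩) _ _ h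

theorem Reach.trans {F : Finset A} {u v w : V} (h : G.Reach F u v) (h' : G.Reach F v w) :
    G.Reach F u w :=
  Relation.ReflTransGen.trans h h'

theorem reach_of_mem {F : Finset A} {a : A} (h : a ∈ F) : G.Reach F (G.src a) (G.tgt a) :=
  Relation.ReflTransGen.single ⟨a, h, rfl, rfl⟩

open Classical in
/-- A walk that starts in a set which no arc leaves remains inside this set. -/
theorem Reach.inside {F : Finset A} {U : Set V} (hU : ∀ a ∈ F, G.src a ∈ U → G.tgt a ∈ U)
    {u v : V} (h : G.Reach F u v) (hu : u ∈ U) :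
    v ∈ U ∧ G.Reach (F.filter fun a => G.src a ∈ U ∧ G.tgt a ∈ U) u v := by
  induction h with
  | refl => exact ⟨hu, .refl⟩
  | tail _ h ih =>
    obtain ⟨a, ha, rfl, rfl⟩ := h
    have := hU a ha ih.1
    exact ⟨this, ih.2.trans (reach_of_mem (by simp [ha, ih.1, this]))⟩

open Classical in
/-- A walk that ends outside a set which no arc leaves remains outside this set. -/
theorem Reach.outside {F : Finset A} {U : Set V} (hU : ∀ a ∈ F, G.src a ∈ U → G.tgt a ∈ U)
    {u v : V} (h : G.Reach F u v) (hv : v ∉ U) :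
    u ∉ U ∧ G.Reach (F.filter fun a => G.src a ∉ U ∧ G.tgt a ∉ U) u v := by
  induction h using Relation.ReflTransGen.head_induction_on with
  | refl => exact ⟨hv, .refl⟩
  | head h _ ih =>
    obtain ⟨a, ha, rfl, rfl⟩ := h
    have h' : G.src a ∉ U := fun h => ih.1 (hU a ha h)
    exact ⟨h', (reach_of_mem (by simp [ha, ih.1, h'])).trans ih.2⟩

/-- A telescoping sum. Testing against all potentials expresses flow conservation without vertex
degrees, so `V` need not be finite. -/
theorem DiPath.sum_potential {u v : V} (q : G.DiPath u v) (h : V → ℤ) :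
    ∑ k, (h (G.src (q.arc k)) - h (G.tgt (q.arc k))) = h u - h v := by
  have e : ∀ (n : ℕ) (g : Fin (n + 1) → ℤ),
      ∑ k : Fin n, (g k.castSucc - g k.succ) = g 0 - g (Fin.last n) := by
    intro n
    induction n with
    | zero => simp
    | succ n ih =>
      intro g
      rw [Fin.sum_univ_castSucc]
      have := ih fun k => g k.castSucc
      simp only [Fin.succ_castSucc, this]
      simp
  simp only [q.src_arc, q.tgt_arc]
  rw [e q.len fun k => h (q.vert k), q.vert_zero, q.vert_last]

end Walks

/-! ### Flow decomposition and residual augmentation -/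

section Flows

variable {V A : Type*} [DecidableEq A] {G : MultiDigraph V A} {s t : V} {ℓ : ℕ}

theorem DiPath.sum_image_potential (q : G.DiPath s t) (h : V → ℤ) :
    ∑ a ∈ Finset.univ.image q.arc, (h (G.src a) - h (G.tgt a)) = h s - h t := by
  rw [Finset.sum_image fun i _ j _ e => q.arc_injective e, q.sum_potential]

theorem DisjointPaths.mem_arcs {X : Finset A} (P : G.DisjointPaths s t ℓ X) {a : A} :
    a ∈ P.arcs ↔ ∃ i k, (P.path i).arc k = a := by
  simp [DisjointPaths.arcs]

theorem DisjointPaths.arcs_subset {X : Finset A} (P : G.DisjointPaths s t ℓ X) : P.arcs ⊆ X := by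
  intro a ha
  obtain ⟨i, k, rfl⟩ := P.mem_arcs.1 ha
  exact P.arc_mem i k

theorem DisjointPaths.sum_potential {X : Finset A} (P : G.DisjointPaths s t ℓ X) (h : V → ℤ) :
    ∑ a ∈ P.arcs, (h (G.src a) - h (G.tgt a)) = ℓ * (h s - h t) := by
  rw [DisjointPaths.arcs, Finset.sum_biUnion]
  · simp only [(P.path _).sum_image_potential h]
    simp [mul_sub]
  · intro i _ j _ hij
    simp only [Function.onFun, Finset.disjoint_left, Finset.mem_image, Finset.mem_univ, true_and]
    rintro _ ⟨k, rfl⟩ ⟨m, e⟩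
    exact P.disjoint i j hij k m e.symm

/-- The same paths in a larger arc set. -/
def DisjointPaths.mono {X X' : Finset A} (P : G.DisjointPaths s t ℓ X) (h : X ⊆ X') :
    G.DisjointPaths s t ℓ X' where
  path := P.path
  arc_mem i k := h (P.arc_mem i k)
  disjoint := P.disjoint

/-- Flow decomposition: an arc set with the balances of an `s`-`t` flow of value `ℓ` contains `ℓ`
arc-disjoint paths. -/
theorem nonempty_disjointPaths_of_potential (ℓ : ℕ) (F : Finset A)
    (hF : ∀ h : V → ℤ, ∑ a ∈ F, (h (G.src a) - h (G.tgt a)) = ℓ * (h s - h t)) :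
    Nonempty (G.DisjointPaths s t ℓ F) := by
  classical
  induction ℓ generalizing F with
  | zero => exact ⟨⟨Fin.elim0, fun i => i.elim0, fun i => i.elim0⟩⟩
  | succ ℓ ih =>
    -- Otherwise the indicator of the set reachable from `s` is a potential with total at most `0`,
    -- since no arc of `F` leaves this set, while the balance demands `ℓ + 1`.
    have hr : G.Reach F s t := by
      by_contra hr
      have h := hF fun v => if G.Reach F s v then 1 else 0
      have h0 : G.Reach F s s := .refl
      have hle : ∑ a ∈ F, ((if G.Reach F s (G.src a) then (1 : ℤ) else 0) -
          (if G.Reach F s (G.tgt a) then 1 else 0)) ≤ 0 := by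
        refine Finset.sum_nonpos fun a ha => ?_
        by_cases h1 : G.Reach F s (G.src a)
        · simp [h1, h1.trans (reach_of_mem ha)]
        · simp only [h1, if_false]
          split_ifs <;> simp
      simp only [h0, hr, if_true, if_false] at h
      push_cast at h
      omega
    obtain ⟨q, hq⟩ := hr.exists_diPath
    set K := Finset.univ.image q.arc with hK
    have hKF : K ⊆ F := by
      intro a ha
      obtain ⟨k, -, rfl⟩ := Finset.mem_image.1 ha
      exact hq k
    obtain ⟨R⟩ := ih (F \ K) fun h => by
      have h1 := Finset.sum_sdiff hKF (f := fun a => h (G.src a) - h (G.tgt a))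
      rw [hF, q.sum_image_potential] at h1
      push_cast at h1
      linarith
    have hR : ∀ i m k, (R.path i).arc m ≠ q.arc k := fun i m k e =>
      (Finset.mem_sdiff.1 (R.arc_mem i m)).2 (e ▸ Finset.mem_image_of_mem _ (Finset.mem_univ k))
    refine ⟨⟨Fin.cons q R.path, fun i => ?_, fun i j => ?_⟩⟩
    · refine Fin.cases hq (fun i m => ?_) i
      exact (Finset.mem_sdiff.1 (R.arc_mem i m)).1
    · refine Fin.cases ?_ (fun i => ?_) i
      · refine Fin.cases (fun h => (h rfl).elim) (fun j _ k m => ?_) j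
        exact (hR j m k).symm
      · refine Fin.cases (fun _ k m => ?_) (fun j h => ?_) j
        · exact hR i k m
        · exact R.disjoint i j fun e => h (e ▸ rfl)

/-- If the arc set `P.arcs ∪ S` still contains `ℓ` arc-disjoint paths after the deletion of an arc
`f` of `P`, then the residual graph has a path from the tail of `f` to its head. -/
theorem DisjointPaths.reach_residual {X S : Finset A} (P : G.DisjointPaths s t ℓ X)
    {f : A} (hf : f ∈ P.arcs) (hS : Disjoint S P.arcs)
    (R : G.DisjointPaths s t ℓ ((P.arcs ∪ S).erase f)) :
    (G.flip P.arcs).Reach (S ∪ P.arcs) (G.src f) (G.tgt f) := by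
  classical
  by_contra hr
  set r : V → Prop := (G.flip P.arcs).Reach (S ∪ P.arcs) (G.src f) with hrdef
  have h0 : r (G.src f) := .refl
  have step : ∀ a ∈ S ∪ P.arcs, r ((G.flip P.arcs).src a) → r ((G.flip P.arcs).tgt a) :=
    fun a ha h => Reach.trans h (reach_of_mem ha)
  -- With the indicator of the residually reachable set as potential, arcs of `P` contribute at
  -- least `0`, arcs of `S` at most `0`, and `f` contributes `1`. Both path systems have the same
  -- total, but `R` must do without `f`.
  let h : V → ℤ := fun v => if r v then 1 else 0
  have hX : ∀ a ∈ P.arcs, 0 ≤ h (G.src a) - h (G.tgt a) := by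
    intro a ha
    have := step a (Finset.mem_union_right _ ha)
    simp only [flip, ha, if_true] at this
    simp only [h]
    split_ifs <;> simp_all
  have hSn : ∀ a ∈ S, h (G.src a) - h (G.tgt a) ≤ 0 := by
    intro a ha
    have := step a (Finset.mem_union_left _ ha)
    simp only [flip, Finset.disjoint_left.1 hS ha, if_false] at this
    simp only [h]
    split_ifs <;> simp_all
  have h1 := P.sum_potential h
  have h2 := R.sum_potential h
  have h3 := Finset.sum_inter_add_sum_sdiff R.arcs P.arcs fun a => h (G.src a) - h (G.tgt a)
  have h4 : ∑ a ∈ R.arcs \ P.arcs, (h (G.src a) - h (G.tgt a)) ≤ 0 := by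
    refine Finset.sum_nonpos fun a ha => hSn a ?_
    have := R.arcs_subset (Finset.mem_sdiff.1 ha).1
    simp only [Finset.mem_erase, Finset.mem_union, Finset.mem_sdiff] at this ha
    tauto
  have h5 : ∑ a ∈ R.arcs ∩ P.arcs, (h (G.src a) - h (G.tgt a)) ≤
      ∑ a ∈ P.arcs.erase f, (h (G.src a) - h (G.tgt a)) := by
    refine Finset.sum_le_sum_of_subset_of_nonneg (fun a ha => ?_)
      fun a ha _ => hX a (Finset.mem_of_mem_erase ha)
    have := R.arcs_subset (Finset.mem_inter.1 ha).1
    simp only [Finset.mem_erase, Finset.mem_inter] at this ha ⊢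
    tauto
  have h6 := Finset.add_sum_erase P.arcs (fun a => h (G.src a) - h (G.tgt a)) hf
  have h7 : h (G.src f) - h (G.tgt f) = 1 := by simp [h, h0, hr]
  omega

/-- Augmentation: if the residual graph has a path from the tail of `f` to its head, then
`P.arcs ∪ S` still contains `ℓ` arc-disjoint paths after the deletion of `f`. -/
theorem DisjointPaths.nonempty_of_reach_residual {X S : Finset A} (P : G.DisjointPaths s t ℓ X)
    {f : A} (hf : f ∈ P.arcs)
    (hr : (G.flip P.arcs).Reach (S ∪ P.arcs) (G.src f) (G.tgt f)) :
    Nonempty (G.DisjointPaths s t ℓ ((P.arcs ∪ S).erase f)) := by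
  obtain ⟨q, hq⟩ := hr.exists_diPath
  set K := Finset.univ.image q.arc with hK
  -- The reversal of `f` ends at the tail of `f`, where the simple path `q` starts.
  have hfK : f ∉ K := by
    intro h
    obtain ⟨k, -, hk⟩ := Finset.mem_image.1 h
    have h1 := q.tgt_arc k
    simp only [flip, hk, hf, if_true] at h1
    have h2 := q.vert_injective (h1.symm.trans q.vert_zero.symm)
    exact Fin.succ_ne_zero k h2
  have hKS : K ⊆ S ∪ P.arcs := by
    intro a ha
    obtain ⟨k, -, rfl⟩ := Finset.mem_image.1 ha
    exact hq k
  -- Augmenting along `q` adds the balance of one unit from the tail of `f` to its head; erasing `f`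
  -- cancels precisely this unit.
  have hfd : f ∈ (P.arcs \ K) ∪ (K \ P.arcs) := by simp [hf, hfK]
  obtain ⟨R⟩ := nonempty_disjointPaths_of_potential (G := G) (s := s) (t := t) ℓ
      (((P.arcs \ K) ∪ (K \ P.arcs)).erase f) fun h => by
    have h1 := Finset.add_sum_erase _ (fun a => h (G.src a) - h (G.tgt a)) hfd
    rw [Finset.sum_union (disjoint_sdiff_sdiff)] at h1
    have h2 := P.sum_potential h
    have h3 := q.sum_image_potential h
    rw [← hK, ← Finset.sum_inter_add_sum_sdiff K P.arcs] at h3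
    rw [← Finset.sum_inter_add_sum_sdiff P.arcs K, Finset.inter_comm] at h2
    have h4 : ∑ a ∈ K ∩ P.arcs, (h ((G.flip P.arcs).src a) - h ((G.flip P.arcs).tgt a)) =
        -∑ a ∈ K ∩ P.arcs, (h (G.src a) - h (G.tgt a)) := by
      rw [← Finset.sum_neg_distrib]
      refine Finset.sum_congr rfl fun a ha => ?_
      simp [flip, (Finset.mem_inter.1 ha).2]
    have h5 : ∑ a ∈ K \ P.arcs, (h ((G.flip P.arcs).src a) - h ((G.flip P.arcs).tgt a)) =
        ∑ a ∈ K \ P.arcs, (h (G.src a) - h (G.tgt a)) := by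
      refine Finset.sum_congr rfl fun a ha => ?_
      simp [flip, (Finset.mem_sdiff.1 ha).2]
    rw [h4, h5] at h3
    linarith
  refine ⟨R.mono (Finset.erase_subset_erase _ fun a ha => ?_)⟩
  have := @hKS a
  simp only [Finset.mem_union, Finset.mem_sdiff] at *
  tauto

end Flows

end MultiDigraph

/-! ### Feasibility in the residual digraph -/

namespace FTAugInstance

/-- The last position in `p` and the first position outside `p`, for a predicate `p` that holds on
an initial part of the interval from `a` to `b`. -/
theorem exists_threshold {n : ℕ} (p : Fin (n + 1) → Prop) {a b : Fin (n + 1)} (hab : a ≤ b)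
    (hp : ∀ k k', a ≤ k → k ≤ k' → k' ≤ b → p k' → p k) :
    ∃ z w, a ≤ z ∧ z ≤ w ∧ w ≤ b ∧ (∀ k, a ≤ k → k ≤ b → p k → k ≤ z) ∧
      (∀ k, a ≤ k → k ≤ b → ¬ p k → w ≤ k) ∧ (p z ∨ z = a) ∧ (¬ p w ∨ w = b) := by
  classical
  -- If `p` fails already at `a`, both thresholds are `a`; if it still holds at `b`, both are `b`.
  by_cases ha : p a
  · by_cases hb : p b
    · exact ⟨b, b, hab, le_rfl, le_rfl, fun _ _ h _ => h,
        fun k h1 h2 h3 => (h3 (hp k b h1 h2 le_rfl hb)).elim, .inl hb, .inr rfl⟩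
    · obtain ⟨z, hz, hz'⟩ := Finset.exists_max_image ((Finset.Icc a b).filter p) id
        ⟨a, by simp [hab, ha]⟩
      obtain ⟨w, hw, hw'⟩ := Finset.exists_min_image ((Finset.Icc a b).filter fun k => ¬ p k) id
        ⟨b, by simp [hab, hb]⟩
      simp only [Finset.mem_filter, Finset.mem_Icc, id, and_imp] at hz hw hz' hw'
      refine ⟨z, w, hz.1.1, ?_, hw.1.2, hz', hw', .inl hz.2, .inl hw.2⟩
      by_contra h
      exact hw.2 (hp w z hw.1.1 (not_le.1 h).le hz.1.2 hz.2)
  · exact ⟨a, a, le_rfl, le_rfl, hab, fun k h1 h2 h3 => (ha (hp a k le_rfl h1 h2 h3)).elim,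
      fun _ h _ _ => h, .inr rfl, .inl ha⟩

variable {V A : Type*} {ℓ : ℕ} {J : FTAugInstance V A ℓ} {P : J.Paths}

/-- The total number of arcs between two nodes. -/
def gap (x y : J.Node P) : ℕ := ∑ i, ((y i : ℕ) - x i)

/-- The condition `x i < y i` is there because subtraction is truncated. -/
theorem gap_lt {x y x' y' : J.Node P} (hx : x ≤ x') (hy : y' ≤ y)
    (h : ∃ i, x i < y i ∧ (x i < x' i ∨ y' i < y i)) : gap x' y' < gap x y := by
  obtain ⟨i, hi, h⟩ := h
  refine Finset.sum_lt_sum (fun j _ => ?_) ⟨i, Finset.mem_univ i, ?_⟩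
  · have := hx j
    have := hy j
    simp only [Fin.le_def] at *
    omega
  · have := hx i
    have := hy i
    simp only [Fin.le_def, Fin.lt_def] at *
    omega

variable [DecidableEq A] (J P)

/-- The residual digraph with respect to the flow `X₀`. -/
abbrev residual : MultiDigraph V A := J.graph.flip J.X₀

/-- Between the nodes `x` and `y`, the arcs of `S` together with the reversed subpaths lead from the
tail of every vulnerable arc to its head. -/
def Protects (S : Finset A) (x y : J.Node P) : Prop :=
  ∀ f ∈ J.segs P x y, f ∈ J.M →
    J.residual.Reach (S ∪ J.segs P x y) (J.graph.src f) (J.graph.tgt f)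

variable {J P}

theorem mem_segs {x y : J.Node P} {a : A} :
    a ∈ J.segs P x y ↔ ∃ i k, x i ≤ k.castSucc ∧ k.succ ≤ y i ∧ (P.path i).arc k = a := by
  simp [segs, seg, and_assoc]

theorem mem_seg {x y : J.Node P} {i : Fin ℓ} {a : A} :
    a ∈ J.seg P x y i ↔ ∃ k, x i ≤ k.castSucc ∧ k.succ ≤ y i ∧ (P.path i).arc k = a := by
  simp [seg, and_assoc]

theorem segs_subset (x y : J.Node P) : J.segs P x y ⊆ J.X₀ := by
  intro a ha
  obtain ⟨i, k, -, -, rfl⟩ := mem_segs.1 ha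
  exact P.arc_mem i k

theorem segs_mono {x y x' y' : J.Node P} (hx : x ≤ x') (hy : y' ≤ y) :
    J.segs P x' y' ⊆ J.segs P x y := by
  intro a ha
  obtain ⟨i, k, h1, h2, rfl⟩ := mem_segs.1 ha
  exact mem_segs.2 ⟨i, k, (hx i).trans h1, h2.trans (hy i), rfl⟩

theorem segs_start_end : J.segs P (J.startNode P) (J.endNode P) = P.arcs := by
  ext a
  rw [mem_segs, P.mem_arcs]
  simp [startNode, endNode, Fin.le_last]

/-- Feasibility in terms of the residual digraph. -/
theorem isFeasible_iff (hX : J.X₀ = P.arcs) {S : Finset A} :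
    J.IsFeasible S ↔ Disjoint S J.X₀ ∧ J.Protects P S (J.startNode P) (J.endNode P) := by
  refine and_congr_right fun hd => ?_
  simp only [Protects, segs_start_end, residual, hX] at hd ⊢
  refine ⟨fun h f hf hM => P.reach_residual hf hd (h f hM).some, fun h f hM => ?_⟩
  by_cases hf : f ∈ P.arcs
  · exact P.nonempty_of_reach_residual hf (h f hf hM)
  · exact ⟨P.core.mono fun a ha => Finset.mem_erase.2
      ⟨fun e => hf (e ▸ ha), Finset.mem_union_left _ ha⟩⟩

theorem residual_src_arc (i : Fin ℓ) (k : Fin (P.path i).len) :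
    J.residual.src ((P.path i).arc k) = (P.path i).vert k.succ := by
  simp [residual, MultiDigraph.flip, P.arc_mem i k, (P.path i).tgt_arc]

theorem residual_tgt_arc (i : Fin ℓ) (k : Fin (P.path i).len) :
    J.residual.tgt ((P.path i).arc k) = (P.path i).vert k.castSucc := by
  simp [residual, MultiDigraph.flip, P.arc_mem i k, (P.path i).src_arc]

/-- Reversed arcs lead towards `s`. Hence a set that no residual arc leaves meets each subpath in an
initial part. -/
theorem reach_backward {x y : J.Node P} {i : Fin ℓ} {a b : Fin ((P.path i).len + 1)}
    (ha : x i ≤ a) (hab : a ≤ b) (hb : b ≤ y i) :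
    J.residual.Reach (J.segs P x y) ((P.path i).vert b) ((P.path i).vert a) := by
  induction b using Fin.induction with
  | zero =>
    obtain rfl : a = 0 := Fin.le_zero_iff.1 hab
    exact .refl
  | succ k ih =>
    rcases hab.eq_or_lt with rfl | hlt
    · exact .refl
    · have hk : a ≤ k.castSucc := Fin.le_castSucc_iff.2 hlt
      refine MultiDigraph.Reach.trans ?_ (ih hk (Fin.castSucc_lt_succ.le.trans hb))
      rw [← residual_src_arc, ← residual_tgt_arc]
      exact MultiDigraph.reach_of_mem (mem_segs.2 ⟨i, k, ha.trans hk, hb, rfl⟩)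

/-! ### Preprocessing preserves optimality -/

section Preprocessing

variable (I : FTAugInstance V A ℓ) (Q : I.Paths)

theorem isFeasible_of_normalize {S : Finset A} (hS : (I.normalize Q).IsFeasible S) :
    I.IsFeasible (S \ I.X₀) := by
  refine ⟨Finset.sdiff_disjoint, fun f hf => (hS.2 f hf).map fun R =>
    R.mono (Finset.erase_subset_erase _ fun a ha => ?_)⟩
  have h : a ∈ Q.arcs → a ∈ I.X₀ := fun h => Q.arcs_subset h
  simp only [normalize, Finset.mem_union, Finset.mem_sdiff] at ha ⊢
  tauto

theorem isFeasible_normalize {S : Finset A} (hS : I.IsFeasible S) :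
    (I.normalize Q).IsFeasible (S ∪ I.X₀ \ Q.arcs) := by
  refine ⟨Finset.disjoint_union_left.2 ⟨hS.1.mono_right Q.arcs_subset, Finset.sdiff_disjoint⟩,
    fun f hf => (hS.2 f hf).map fun R => R.mono (Finset.erase_subset_erase _ fun a ha => ?_)⟩
  simp only [normalize, Finset.mem_union, Finset.mem_sdiff] at ha ⊢
  tauto

theorem sum_normalize {S : Finset A} (hS : Disjoint S I.X₀) :
    ∑ a ∈ S, (I.normalize Q).c a = ∑ a ∈ S, I.c a :=
  Finset.sum_congr rfl fun _ ha => if_neg fun h =>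
    Finset.disjoint_left.1 hS ha (Finset.mem_sdiff.1 h).1

/-- A competitor `T` for `I` becomes one for the normalized instance, at no extra cost, by adding
the discarded arcs. -/
theorem isOptimal_of_normalize {S : Finset A} (hS : (I.normalize Q).IsOptimal S) :
    I.IsOptimal (S \ I.X₀) := by
  refine ⟨isFeasible_of_normalize I Q hS.1, fun T hT => ?_⟩
  have h0 : ∑ a ∈ I.X₀ \ Q.arcs, (I.normalize Q).c a = 0 :=
    Finset.sum_eq_zero fun a ha => if_pos ha
  calc ∑ a ∈ S \ I.X₀, I.c a
      = ∑ a ∈ S \ I.X₀, (I.normalize Q).c a := (sum_normalize I Q Finset.sdiff_disjoint).symm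
    _ ≤ ∑ a ∈ S, (I.normalize Q).c a := Finset.sum_le_sum_of_subset Finset.sdiff_subset
    _ ≤ ∑ a ∈ T ∪ I.X₀ \ Q.arcs, (I.normalize Q).c a := hS.2 _ (isFeasible_normalize I Q hT)
    _ = ∑ a ∈ T, I.c a := by
      rw [Finset.sum_union (hT.1.mono_right Finset.sdiff_subset), h0, add_zero,
        sum_normalize I Q hT.1]

end Preprocessing

/-! ### From protecting sets to walks in 𝒟 -/

variable [Fintype A]

/-- Every solution of `I(x, y)` protects the vulnerable arcs between `x` and `y`. -/
theorem protects_of_isSolution {F : Finset A} {x y : J.Node P}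
    (hF : (J.dsn P x y).IsSolution F) : J.Protects P (F \ J.X₀) x y := by
  intro f hf _
  obtain ⟨i, k, h1, h2, rfl⟩ := mem_segs.1 hf
  have hsub : F ⊆ F \ J.X₀ ∪ J.segs P x y := by
    intro a ha
    have := hF.1 ha
    simp only [dsn, Finset.mem_union, Finset.mem_sdiff, Finset.mem_univ, true_and] at this ⊢
    tauto
  have hk : k.castSucc ≤ k.succ := Fin.castSucc_lt_succ.le
  rw [(P.path i).src_arc, (P.path i).tgt_arc]
  -- Back from the tail of the arc to `x i`, through `F` to `y i`, and back to the head.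
  exact ((reach_backward le_rfl h1 (hk.trans h2)).mono Finset.subset_union_right).trans
    (((hF.2 i).mono hsub).trans
      ((reach_backward (h1.trans hk) h2 le_rfl).mono Finset.subset_union_right))

theorem sum_cost_dsn (F : Finset A) (x y : J.Node P) :
    ∑ a ∈ F, (J.dsn P x y).cost a = ∑ a ∈ F \ J.X₀, J.c a := by
  rw [← Finset.filter_notMem_eq_sdiff, Finset.sum_filter]
  exact Finset.sum_congr rfl fun a _ => by simp [dsn, ite_not]

open Classical in
/-- If two terminals of `I(x, y)` are separated by a set which no residual arc leaves, then the
task of protecting the arcs between `x` and `y` splits into two smaller ones. -/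
theorem Protects.split {S : Finset A} {x y : J.Node P} (hS : J.Protects P S x y) (hxy : x ≤ y)
    {u v : V} (hu : u ∈ (J.dsn P x y).terminals) (hv : v ∈ (J.dsn P x y).terminals)
    (huv : ¬ J.residual.Reach (S ∪ J.segs P x y) u v) :
    ∃ z w S₁ S₂, x ≤ z ∧ w ≤ y ∧ J.IsLink₁ P z w ∧ J.Protects P S₁ x z ∧ J.Protects P S₂ w y ∧
      gap x z < gap x y ∧ gap w y < gap x y ∧ S₁ ⊆ S ∧ S₂ ⊆ S ∧ Disjoint S₁ S₂ := by
  set H := J.residual with hH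
  set U : Set V := {w | H.Reach (S ∪ J.segs P x y) u w} with hUdef
  have hU : ∀ a ∈ S ∪ J.segs P x y, H.src a ∈ U → H.tgt a ∈ U :=
    fun a ha h => MultiDigraph.Reach.trans h (MultiDigraph.reach_of_mem ha)
  have huU : u ∈ U := Relation.ReflTransGen.refl
  have hvU : v ∉ U := huv
  have hdown : ∀ i k k', x i ≤ k → k ≤ k' → k' ≤ y i → (P.path i).vert k' ∈ U →
      (P.path i).vert k ∈ U := fun i k k' h1 h2 h3 h =>
    MultiDigraph.Reach.trans h
      ((reach_backward h1 h2 h3).mono Finset.subset_union_right)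
  -- On each `P i`, `z i` is the last position in `U` and `w i` the first outside, with defaults `x
  -- i` and `y i` if there is none.
  choose z w hxz hzw hwy hz hw hz' hw' using fun i =>
    exists_threshold (fun k => (P.path i).vert k ∈ U) (hxy i) (hdown i)
  have hzy : z ≤ y := fun i => (hzw i).trans (hwy i)
  have hxw : x ≤ w := fun i => (hxz i).trans (hzw i)
  have hcs : ∀ {n : ℕ} (k : Fin n), k.castSucc < k.succ := fun k => Fin.castSucc_lt_succ
  have left : ∀ i (k : Fin (P.path i).len), x i ≤ k.castSucc → k.succ ≤ z i →
      (P.path i).vert k.succ ∈ U := by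
    intro i k h1 h2
    rcases hz' i with h | h
    · exact hdown i _ _ (h1.trans (hcs k).le) h2 (hzy i) h
    · exact absurd (h2.trans (h.le.trans h1)) (hcs k).not_ge
  have right : ∀ i (k : Fin (P.path i).len), w i ≤ k.castSucc → k.succ ≤ y i →
      (P.path i).vert k.castSucc ∉ U := by
    intro i k h1 h2 h3
    rcases hw' i with h | h
    · exact h (hdown i _ _ (hxw i) h1 ((hcs k).le.trans h2) h3)
    · exact absurd (h2.trans (h.ge.trans h1)) (hcs k).not_ge
  refine ⟨z, w, S.filter fun a => H.src a ∈ U ∧ H.tgt a ∈ U,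
    S.filter fun a => H.src a ∉ U ∧ H.tgt a ∉ U, hxz, hwy, ⟨hzw, fun i => ?_⟩, ?_, ?_, ?_, ?_,
    Finset.filter_subset _ _, Finset.filter_subset _ _, ?_⟩
  -- An arc between `z` and `w` has its tail in `U` and its head outside; were it vulnerable, a
  -- residual walk would leave `U`.
  · rw [Finset.disjoint_left]
    intro f hf hM
    obtain ⟨k, h1, h2, rfl⟩ := mem_seg.1 hf
    have hxk := (hxz i).trans h1
    have hky := h2.trans (hwy i)
    have hr := hS _ (mem_segs.2 ⟨i, k, hxk, hky, rfl⟩) hM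
    rw [(P.path i).src_arc, (P.path i).tgt_arc] at hr
    by_cases h3 : (P.path i).vert k.succ ∈ U
    · exact absurd ((hz i _ (hxk.trans (hcs k).le) hky h3).trans h1) (hcs k).not_ge
    · by_cases h4 : (P.path i).vert k.castSucc ∈ U
      · exact h3 (hr.inside hU h4).1
      · exact absurd (h2.trans (hw i _ hxk ((hcs k).le.trans hky) h4)) (hcs k).not_ge
  -- The protecting walk starts in `U`, so it stays there, and path arcs inside `U` lie before `z`.
  -- On the other side, the walk ends outside `U` and so never meets `U`.
  · intro f hf hM
    have hr := hS f (segs_mono le_rfl hzy hf) hM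
    obtain ⟨i, k, h1, h2, rfl⟩ := mem_segs.1 hf
    have hsrc : J.graph.src ((P.path i).arc k) ∈ U := by
      rw [(P.path i).src_arc]
      exact hdown i _ _ h1 (hcs k).le (h2.trans (hzy i)) (left i k h1 h2)
    refine (hr.inside hU hsrc).2.mono fun a ha => ?_
    obtain ⟨ha, ha1, ha2⟩ := Finset.mem_filter.1 ha
    rcases Finset.mem_union.1 ha with ha | ha
    · exact Finset.mem_union_left _ (Finset.mem_filter.2 ⟨ha, ha1, ha2⟩)
    · obtain ⟨j, m, h3, h4, rfl⟩ := mem_segs.1 ha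
      rw [hH, residual_src_arc] at ha1
      exact Finset.mem_union_right _
        (mem_segs.2 ⟨j, m, h3, hz j _ (h3.trans (hcs m).le) h4 ha1, rfl⟩)
  · intro f hf hM
    have hr := hS f (segs_mono hxw le_rfl hf) hM
    obtain ⟨i, k, h1, h2, rfl⟩ := mem_segs.1 hf
    have htgt : J.graph.tgt ((P.path i).arc k) ∉ U := by
      rw [(P.path i).tgt_arc]
      exact fun h => right i k h1 h2 (hdown i _ _ ((hxw i).trans h1) (hcs k).le h2 h)
    refine (hr.outside hU htgt).2.mono fun a ha => ?_
    obtain ⟨ha, ha1, ha2⟩ := Finset.mem_filter.1 ha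
    rcases Finset.mem_union.1 ha with ha | ha
    · exact Finset.mem_union_left _ (Finset.mem_filter.2 ⟨ha, ha1, ha2⟩)
    · obtain ⟨j, m, h3, h4, rfl⟩ := mem_segs.1 ha
      rw [hH, residual_tgt_arc] at ha2
      exact Finset.mem_union_right _
        (mem_segs.2 ⟨j, m, hw j _ h3 ((hcs m).le.trans h4) ha2, h4, rfl⟩)
  -- Whichever end of its pair `v` is, `y j` lies outside `U`, so `z j < y j`. Dually, `u` gives an
  -- `i` with `x i < w i`.
  · obtain ⟨j, hj, hvj⟩ := hv
    have hlt : x j < y j := lt_of_le_of_ne (hxy j) fun e => hj (congrArg _ e)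
    have hyj : (P.path j).vert (y j) ∉ U := by
      rcases hvj with rfl | rfl
      · exact fun h => hvU (hdown j _ _ le_rfl (hxy j) le_rfl h)
      · exact hvU
    refine gap_lt le_rfl hzy ⟨j, hlt, .inr (lt_of_le_of_ne (hzy j) fun e => ?_)⟩
    rcases hz' j with h | h
    · exact hyj (e ▸ h)
    · exact hlt.ne (h.symm.trans e)
  · obtain ⟨i, hi, hui⟩ := hu
    have hlt : x i < y i := lt_of_le_of_ne (hxy i) fun e => hi (congrArg _ e)
    have hxi : (P.path i).vert (x i) ∈ U := by
      rcases hui with rfl | rfl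
      · exact huU
      · exact hdown i _ _ le_rfl (hxy i) le_rfl huU
    refine gap_lt hxw le_rfl ⟨i, hlt, .inl (lt_of_le_of_ne (hxw i) fun e => ?_)⟩
    rcases hw' i with h | h
    · exact h (e ▸ hxi)
    · exact hlt.ne (e.trans h)
  · rw [Finset.disjoint_filter]
    exact fun a _ h h' => h'.1 h.1

variable {sol : J.Node P → J.Node P → Finset A}

/-- Arcs that protect everything between `x` and `y` give a walk of at most the same weight. -/
theorem Protects.exists_isWalk (hsol : J.IsSolver P sol) {S : Finset A} {x y : J.Node P}
    (hS : J.Protects P S x y) (hd : Disjoint S J.X₀) (hxy : x ≤ y) :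
    ∃ l, (J.aux P sol).IsWalk x l y ∧ (l.map (J.linkWeight P sol)).sum ≤ ∑ a ∈ S, J.c a := by
  induction hn : gap x y using Nat.strong_induction_on generalizing x y S with
  | _ n ih =>
  subst hn
  -- Stated for an arbitrary `T`, as it serves both `S` and the computed solution.
  have divide : ∀ T : Finset A, J.Protects P T x y → Disjoint T J.X₀ →
      (∃ u ∈ (J.dsn P x y).terminals, ∃ v ∈ (J.dsn P x y).terminals,
        ¬ J.residual.Reach (T ∪ J.segs P x y) u v) →
      ∃ l, (J.aux P sol).IsWalk x l y ∧
        (l.map (J.linkWeight P sol)).sum ≤ ∑ a ∈ T, J.c a := by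
    rintro T hT hTd ⟨u, hu, v, hv, huv⟩
    obtain ⟨z, w, S₁, S₂, hxz, hwy, hzw, h1, h2, hg1, hg2, hs1, hs2, hdis⟩ :=
      hT.split hxy hu hv huv
    obtain ⟨l₁, hl₁, hc₁⟩ := ih _ hg1 h1 (hTd.mono_left hs1) hxz rfl
    obtain ⟨l₂, hl₂, hc₂⟩ := ih _ hg2 h2 (hTd.mono_left hs2) hwy rfl
    have hm : (J.aux P sol).IsWalk z [⟨(z, w), .inl hzw⟩] w := ⟨rfl, rfl⟩
    refine ⟨l₁ ++ ([⟨(z, w), .inl hzw⟩] ++ l₂), hl₁.append (hm.append hl₂), ?_⟩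
    have h0 : J.linkWeight P sol ⟨(z, w), .inl hzw⟩ = 0 := by simp [linkWeight, hzw]
    simp only [List.map_append, List.sum_append, List.map_singleton, List.sum_singleton, h0,
      zero_add]
    calc _ ≤ ∑ a ∈ S₁, J.c a + ∑ a ∈ S₂, J.c a := add_le_add hc₁ hc₂
      _ = ∑ a ∈ S₁ ∪ S₂, J.c a := (Finset.sum_union hdis).symm
      _ ≤ _ := Finset.sum_le_sum_of_subset (Finset.union_subset hs1 hs2)
  by_cases h1 : J.IsLink₁ P x y
  · exact ⟨[⟨(x, y), .inl h1⟩], ⟨rfl, rfl⟩, by simp [linkWeight, h1]⟩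
  by_cases h2 : ∃ u ∈ (J.dsn P x y).terminals, ∃ v ∈ (J.dsn P x y).terminals,
      ¬ J.residual.Reach (S ∪ J.segs P x y) u v
  · exact divide S hS hd h2
  push Not at h2
  have hSsol : (J.dsn P x y).IsSolution (S ∪ J.segs P x y) := by
    refine ⟨Finset.union_subset_union (fun a ha => ?_) subset_rfl, fun i => ?_⟩
    · simpa using Finset.disjoint_left.1 hd ha
    · by_cases hi : (J.dsn P x y).source i = (J.dsn P x y).sink i
      · rw [hi]
        exact .refl
      · exact h2 _ ⟨i, hi, .inl rfl⟩ _ ⟨i, hi, .inr rfl⟩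
  obtain ⟨hF, hopt⟩ := hsol x y ⟨_, hSsol⟩
  have hcost := hopt _ hSsol
  have hSX : (S ∪ J.segs P x y) \ J.X₀ = S := by
    rw [Finset.union_sdiff_distrib, Finset.sdiff_eq_empty_iff_subset.2 (segs_subset x y),
      Finset.union_empty, Finset.sdiff_eq_self_of_disjoint hd]
  by_cases h3 : (J.dsn P x y).StronglyConnects (sol x y ∪ J.segs P x y)
  · have hl : J.IsLink₂ P sol x y :=
      ⟨hxy, by simpa [IsLink₁, hxy] using h1, hF, h3⟩
    refine ⟨[⟨(x, y), .inr hl⟩], ⟨rfl, rfl⟩, ?_⟩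
    rw [sum_cost_dsn (S ∪ _), hSX] at hcost
    simpa [linkWeight, h1] using hcost
  -- The computed solution also protects everything between `x` and `y` and costs no more than `S`,
  -- so it can be divided in place of `S`.
  · rw [sum_cost_dsn, sum_cost_dsn, hSX] at hcost
    simp only [DSNInstance.StronglyConnects, not_forall] at h3
    obtain ⟨u, hu, v, hv, huv⟩ := h3
    obtain ⟨l, hl, hlc⟩ := divide (sol x y \ J.X₀) (protects_of_isSolution hF)
      Finset.sdiff_disjoint ⟨u, hu, v, hv, fun h => huv
        (h.mono (Finset.union_subset_union Finset.sdiff_subset subset_rfl))⟩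
    exact ⟨l, hl, hlc.trans hcost⟩

theorem exists_auxPath (hX : J.X₀ = P.arcs) (hsol : J.IsSolver P sol) {S : Finset A}
    (hS : J.IsFeasible S) :
    ∃ q : J.AuxPath P sol, ∑ k, J.linkWeight P sol (q.arc k) ≤ ∑ a ∈ S, J.c a := by
  obtain ⟨hd, hS⟩ := (isFeasible_iff hX).1 hS
  obtain ⟨l, hl, hc⟩ := hS.exists_isWalk hsol hd fun i => Fin.zero_le _
  obtain ⟨q, hq⟩ := hl.exists_diPath
  refine ⟨q, le_trans ?_ hc⟩
  rw [← List.sum_ofFn, ← Function.comp_def (J.linkWeight P sol), ← List.map_ofFn]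
  exact (hq.map _).sum_le_sum fun _ _ => zero_le

/-! ### From paths in 𝒟 to feasible sets -/

/-- A discrete intermediate value argument: if no link steps over the arc, the `i`-th coordinate
never gets past its tail. -/
theorem AuxPath.exists_link (p : J.AuxPath P sol) (i : Fin ℓ) (k : Fin (P.path i).len) :
    ∃ m, (p.arc m).1.1 i ≤ k.castSucc ∧ k.succ ≤ (p.arc m).1.2 i := by
  by_contra! h
  have key : ∀ m, p.vert m i ≤ k.castSucc := by
    intro m
    induction m using Fin.induction with
    | zero => rw [p.vert_zero]; exact Fin.zero_le _
    | succ m ih =>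
      have hs : (p.arc m).1.1 = p.vert m.castSucc := p.src_arc m
      have ht : (p.arc m).1.2 = p.vert m.succ := p.tgt_arc m
      have := h m (hs ▸ ih)
      rw [ht] at this
      exact Fin.le_castSucc_iff.2 this
  have := key (Fin.last _)
  rw [p.vert_last] at this
  exact absurd (this.trans_lt Fin.castSucc_lt_succ) (Fin.le_last k.succ).not_gt

theorem isFeasible_output (hX : J.X₀ = P.arcs) (p : J.AuxPath P sol) :
    J.IsFeasible (J.output P sol p) := by
  classical
  refine (isFeasible_iff hX).2 ⟨?_, fun f hf hM => ?_⟩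
  · refine (Finset.disjoint_biUnion_left _ _ _).2 fun k _ => ?_
    split_ifs
    · exact Finset.sdiff_disjoint
    · exact Finset.disjoint_empty_left _
  · obtain ⟨i, k, -, -, rfl⟩ := mem_segs.1 hf
    obtain ⟨m, h1, h2⟩ := AuxPath.exists_link p i k
    have hmem : (P.path i).arc k ∈ J.seg P (p.arc m).1.1 (p.arc m).1.2 i :=
      mem_seg.2 ⟨k, h1, h2, rfl⟩
    have hl : J.IsLink₂ P sol (p.arc m).1.1 (p.arc m).1.2 :=
      (p.arc m).2.resolve_left fun h => Finset.disjoint_left.1 (h.2 i) hmem hM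
    refine (protects_of_isSolution hl.2.2.1 _ (mem_segs.2 ⟨i, k, h1, h2, rfl⟩) hM).mono
      (Finset.union_subset_union (fun a ha => ?_)
        (segs_mono (fun _ => Fin.zero_le _) fun _ => Fin.le_last _))
    exact Finset.mem_biUnion.2 ⟨m, Finset.mem_univ m, by rwa [if_pos hl]⟩

/-- Only an inequality, since the solutions of different links may share arcs. -/
theorem sum_output_le (p : J.AuxPath P sol) :
    ∑ a ∈ J.output P sol p, J.c a ≤ ∑ k, J.linkWeight P sol (p.arc k) := by
  classical
  have hle : ∀ (s : Finset (Fin p.len)) (F : Fin p.len → Finset A),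
      ∑ a ∈ s.biUnion F, J.c a ≤ ∑ k ∈ s, ∑ a ∈ F k, J.c a := by
    intro s F
    induction s using Finset.induction_on with
    | empty => simp
    | insert k s hk ih =>
      rw [Finset.biUnion_insert, Finset.sum_insert hk]
      calc _ ≤ ∑ a ∈ F k ∪ s.biUnion F, J.c a + ∑ a ∈ F k ∩ s.biUnion F, J.c a :=
            le_self_add
        _ = _ := Finset.sum_union_inter
        _ ≤ _ := by gcongr
  refine (hle _ _).trans (Finset.sum_le_sum fun k _ => ?_)
  split_ifs with h
  · have h1 : ¬ J.IsLink₁ P (p.arc k).1.1 (p.arc k).1.2 := fun h1 =>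
      h.2.1.elim fun i hi => hi (h1.2 i)
    rw [linkWeight, if_neg h1, sum_cost_dsn]
  · simp

/-- A path repeats no link, so its weight is determined by its set of links, and there are finitely
many such sets. -/
theorem exists_isShortest (h : Nonempty (J.AuxPath P sol)) :
    ∃ p : J.AuxPath P sol, J.IsShortest P sol p := by
  classical
  have hfin : (Set.range fun p : J.AuxPath P sol =>
      ∑ k, J.linkWeight P sol (p.arc k)).Finite := by
    refine (Set.finite_range fun T : Finset (J.Link P sol) =>
      ∑ e ∈ T, J.linkWeight P sol e).subset ?_
    rintro _ ⟨p, rfl⟩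
    exact ⟨Finset.univ.image p.arc, Finset.sum_image fun i _ j _ e => p.arc_injective e⟩
  obtain ⟨_, ⟨p, rfl⟩, hp⟩ := Set.exists_min_image _ id hfin (Set.range_nonempty _)
  exact ⟨p, fun q => hp _ ⟨q, rfl⟩⟩

/-- The algorithm is correct on instances in which `X₀` is the union of the paths. -/
theorem isOptimal_output (hX : J.X₀ = P.arcs) (hsol : J.IsSolver P sol) {p : J.AuxPath P sol}
    (hp : J.IsShortest P sol p) : J.IsOptimal (J.output P sol p) := by
  refine ⟨isFeasible_output hX p, fun S hS => ?_⟩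
  obtain ⟨q, hq⟩ := exists_auxPath hX hsol hS
  exact (sum_output_le p).trans ((hp q).trans hq)

end FTAugInstance

theorem mainTheorem9 {V A : Type*} [Fintype A] [DecidableEq A] {ℓ : ℕ}
    (I : FTAugInstance V A ℓ) (P : I.Paths)
    (sol : (I.normalize P).Node P.core → (I.normalize P).Node P.core → Finset A)
    (hsol : (I.normalize P).IsSolver P.core sol) :
    (∀ p : (I.normalize P).AuxPath P.core sol, (I.normalize P).IsShortest P.core sol p →
      (I.normalize P).IsOptimal ((I.normalize P).output P.core sol p) ∧
      I.IsOptimal ((I.normalize P).output P.core sol p \ I.X₀)) ∧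
    ((∃ S, I.IsFeasible S) →
      ∃ p : (I.normalize P).AuxPath P.core sol, (I.normalize P).IsShortest P.core sol p) := by
  have hX : (I.normalize P).X₀ = P.core.arcs := rfl
  refine ⟨fun p hp => ?_, fun ⟨S, hS⟩ => ?_⟩
  · have h := FTAugInstance.isOptimal_output hX hsol hp
    exact ⟨h, FTAugInstance.isOptimal_of_normalize I P h⟩
  · obtain ⟨p, -⟩ :=
      FTAugInstance.exists_auxPath hX hsol (FTAugInstance.isFeasible_normalize I P hS)
    exact FTAugInstance.exists_isShortest ⟨p⟩
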